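/- A finite graph $G$ consists of a finite vertex set $V(G)$ and a symmetric adjacency relation on $V(G)$ (loops are allowed). A homomorphism $G\to H$ is a map $V(G)\to V(H)$ that sends adjacent vertices to adjacent vertices. The product $G\times H$ has vertex set $V(G)\times V(H)$, with $(u,v)$ adjacent to $(u',v')$ if and only if $u$ is adjacent to $u'$ in $G$ and $v$ is adjacent to $v'$ in $H$. For integers $r,s$ with $1\le r\le s/2$, the circular complete graph $K_{s/r}$ has vertex set $\mathbb{Z}_s=\{0,1,\dots,s-1\}$, the integers modulo $s$, with $x$ adjacent to $y$ if and only if $y-x\in\{r,r+1,\dots,s-r\}$ modulo $s$. The circular chromatic number $\chi_c(G)$ is the infimum of the values $\frac{s}{r}$ over all integers $r,s$ with $1\le r\le s/2$ such that there is a homomorphism $G\to K_{s/r}$ (and $\chi_c(G)=\infty$ if there are none). **Corollary.** Let $G$ and $H$ be finite graphs such that $\min\{\chi_c(G),\chi_c(H)\}\le 4$. Then $$\chi_c(G\times H)=\min\{\chi_c(G),\chi_c(H)\}.$$ -/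

import Mathlib

open scoped ENNReal

/-!
A finite graph is a symmetric `Digraph` on a finite vertex type: loops are allowed. Parallel arcs
are irrelevant for the existence of homomorphisms.
-/

namespace Digraph

/-- There is a homomorphism `G → H`, that is, an adjacency-preserving map of the vertices. -/
def HomTo {V W : Type*} (G : Digraph V) (H : Digraph W) : Prop :=
  ∃ f : V → W, ∀ ⦃u v : V⦄, G.Adj u v → H.Adj (f u) (f v)

/-- The (categorical, or direct) product `G × H`. -/
def directProd {V W : Type*} (G : Digraph V) (H : Digraph W) : Digraph (V × W) where
  Adj p q := G.Adj p.1 q.1 ∧ H.Adj p.2 q.2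

/-- The circular complete graph `K_{s/r}`, meant for `1 ≤ r ≤ s / 2`: its vertex set is `ℤ / sℤ`,
and `x`, `y` are adjacent iff `y - x ∈ {r, r + 1, …, s - r}`. -/
def circularComplete (s r : ℕ) : Digraph (ZMod s) where
  Adj x y := r ≤ (y - x).val ∧ (y - x).val ≤ s - r

/-- The circular chromatic number: the infimum in `[0, ∞]` of the values `s / r` such that
`1 ≤ r ≤ s / 2` and `G → K_{s/r}`. It is `∞` when there is no such pair, i.e. when `G` has a
loop. -/
noncomputable def circularChromaticNumber {V : Type*} (G : Digraph V) : ℝ≥0∞ :=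
  sInf {x : ℝ≥0∞ | ∃ s r : ℕ, 1 ≤ r ∧ 2 * r ≤ s ∧ G.HomTo (circularComplete s r) ∧
    x = (s : ℝ≥0∞) / (r : ℝ≥0∞)}

end Digraph

/-! The heart is that `K_{p/q}` with p/q < 4 is multiplicative
(`homTo_circularComplete_or_of_directProd`); a value s/r of the product below the minimum, hence
below 4, would then be attained by a factor. Fix odd closed walks in G and H, of common length N =
2k+1. A homomorphism f on the product gives each vertex u of G a cyclic sequence j ↦ f(u, y j), with
an integral number of turns that is constant along edges since p < 4q (`Linked.winding_eq`);
likewise for H. On the square array f(x i, y j), the row and column turn numbers have odd sum, so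
one is even (`four_mul_dvd_winding_or`). For the factor with even winding, averaging the integer
lifts of each sequence and rounding down gives a homomorphism on the component
(`Linked.adj_liftSum`). Components without odd closed walks are bipartite and map trivially.
Differences are doubled so that deviations from the antipode are integers: a full turn is 2p. -/

namespace Digraph

/-- Twice the deviation of `b - a` from the antipode, as an integer. -/
def step {p : ℕ} (a b : ZMod p) : ℤ := 2 * ((b - a).val : ℤ) - p

/-- The lift of smallest absolute value of twice the difference `b - a`. -/
def shift {p : ℕ} (a b : ZMod p) : ℤ := Int.bmod (2 * (b.val : ℤ) - 2 * (a.val : ℤ)) (2 * p)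

/-! ### Steps and shifts in circular complete graphs -/

section Steps

variable {p q : ℕ}

theorem bmod_eq_of_dvd {x z : ℤ} (h : (2 * p : ℤ) ∣ x - z) (hz : |z| < p) :
    Int.bmod x (2 * p) = z := by
  have h1 : x.bmod (2 * p) = z.bmod (2 * p) := by
    rw [← Int.emod_bmod x, ← Int.emod_bmod z]
    congr 1
    push_cast
    exact Int.emod_eq_emod_iff_emod_sub_eq_zero.2 (Int.emod_eq_zero_of_dvd h)
  rw [h1]
  rw [abs_lt] at hz
  apply Int.bmod_eq_of_le <;> push_cast <;> omega

theorem two_mul_dvd_step_sub [NeZero p] (a b : ZMod p) :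
    (2 * p : ℤ) ∣ step a b - (2 * (b.val : ℤ) - 2 * (a.val : ℤ) - p) := by
  have h : (p : ℤ) ∣ ((b - a).val : ℤ) - ((b.val : ℤ) - (a.val : ℤ)) := by
    rw [← ZMod.intCast_zmod_eq_zero_iff_dvd]
    simp
  obtain ⟨c, hc⟩ := h
  refine ⟨c, ?_⟩
  unfold step
  linear_combination 2 * hc

theorem two_mul_dvd_shift_sub (a b : ZMod p) :
    (2 * p : ℤ) ∣ shift a b - (2 * (b.val : ℤ) - 2 * (a.val : ℤ)) := by
  have := Int.dvd_bmod_sub_self (x := 2 * (b.val : ℤ) - 2 * (a.val : ℤ)) (m := 2 * p)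
  rwa [Nat.cast_mul, Nat.cast_ofNat] at this

theorem abs_step_le (hpq : 2 * q ≤ p) {a b : ZMod p} (h : (circularComplete p q).Adj a b) :
    |step a b| ≤ p - 2 * q := by
  obtain ⟨h1, h2⟩ := h
  unfold step
  rw [abs_le]
  omega

theorem circularComplete_symm (hq : 1 ≤ q) (hpq : 2 * q ≤ p) {a b : ZMod p}
    (h : (circularComplete p q).Adj a b) : (circularComplete p q).Adj b a := by
  have : NeZero p := ⟨by omega⟩
  obtain ⟨h1, h2⟩ := h
  have hne : NeZero (b - a) := ⟨by
    intro h0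
    rw [h0, ZMod.val_zero] at h1
    omega⟩
  have h3 := ZMod.val_neg_of_ne_zero (b - a)
  rw [neg_sub] at h3
  have h4 := ZMod.val_lt (b - a)
  constructor <;> omega

theorem step_symm (hq : 1 ≤ q) (hpq : 2 * q ≤ p) {a b : ZMod p}
    (h : (circularComplete p q).Adj a b) : step b a = -step a b := by
  have : NeZero p := ⟨by omega⟩
  have hne : NeZero (b - a) := ⟨by
    intro h0
    have h1 := h.1
    rw [h0, ZMod.val_zero] at h1
    omega⟩
  have h3 := ZMod.val_neg_of_ne_zero (b - a)
  rw [neg_sub] at h3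
  have h4 := ZMod.val_lt (b - a)
  unfold step
  omega

/-- This is where p < 4q enters: each step is at most p - 2q in absolute value, so two add up to
less than p and cannot wrap around. The two antipodal half turns cancel modulo 2p. -/
theorem shift_eq_step_add_step (hpq : 2 * q ≤ p) (hp4 : p < 4 * q) {a b c : ZMod p}
    (hab : (circularComplete p q).Adj a b) (hbc : (circularComplete p q).Adj b c) :
    shift a c = step a b + step b c := by
  have : NeZero p := ⟨by omega⟩
  apply bmod_eq_of_dvd
  · obtain ⟨m, hm⟩ := two_mul_dvd_step_sub a b
    obtain ⟨n, hn⟩ := two_mul_dvd_step_sub b c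
    exact ⟨1 - m - n, by linear_combination - hm - hn⟩
  · have h1 := abs_step_le hpq hab
    have h2 := abs_step_le hpq hbc
    have := abs_add_le (step a b) (step b c)
    omega

end Steps

/-! ### Cyclic sequences and their windings -/

/-- Consecutive entries of the cyclic sequences `a` and `b` are adjacent in `K_{p/q}`. -/
def Linked {p N : ℕ} (q : ℕ) (a b : ZMod N → ZMod p) : Prop :=
  ∀ l, (circularComplete p q).Adj (a l) (b (l + 1)) ∧ (circularComplete p q).Adj (a l) (b (l - 1))

/-- The total shift of a cyclic sequence, read in steps of two. -/
def winding {p k : ℕ} (a : ZMod (2 * k + 1) → ZMod p) : ℤ := ∑ l, shift (a l) (a (l + 2))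

/-- The lift of the cyclic sequence `a (2 * j)` to the integers (scaled by two). -/
def lift {p N : ℕ} (a : ZMod N → ZMod p) (j : ℕ) : ℤ :=
  2 * ((a 0).val : ℤ) + ∑ i ∈ Finset.range j, shift (a (2 * i)) (a (2 * i + 2))

/-- The sum of the lifts over one period. -/
def liftSum {p k : ℕ} (a : ZMod (2 * k + 1) → ZMod p) : ℤ :=
  ∑ j ∈ Finset.range (2 * k + 1), lift a j

theorem sum_range_natCast {N : ℕ} [NeZero N] (g : ZMod N → ℤ) :
    ∑ i ∈ Finset.range N, g i = ∑ l, g l := by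
  refine Finset.sum_bij (fun i _ => (i : ZMod N)) (by simp) ?_ ?_ (by simp)
  · intro i hi j hj hij
    simp only [Finset.mem_range] at hi hj
    rw [ZMod.natCast_eq_natCast_iff'] at hij
    rwa [Nat.mod_eq_of_lt hi, Nat.mod_eq_of_lt hj] at hij
  · intro b _
    exact ⟨b.val, by simpa using ZMod.val_lt b, by simp⟩

theorem sum_range_two_mul {k : ℕ} (g : ZMod (2 * k + 1) → ℤ) (c : ZMod (2 * k + 1)) :
    ∑ i ∈ Finset.range (2 * k + 1), g (c + 2 * i) = ∑ l, g l := by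
  have hodd : IsUnit (2 : ZMod (2 * k + 1)) := by
    have : IsUnit ((2 : ℕ) : ZMod (2 * k + 1)) := by
      rw [ZMod.isUnit_iff_coprime]
      simp
    exact_mod_cast this
  rw [sum_range_natCast fun l => g (c + 2 * l)]
  refine Fintype.sum_bijective (fun l => c + 2 * l) ?_ _ _ (fun _ => rfl)
  rw [← Finite.injective_iff_bijective]
  intro x y hxy
  exact hodd.mul_left_cancel (add_left_cancel hxy)

theorem sum_add_right {N : ℕ} [NeZero N] (g : ZMod N → ℤ) (c : ZMod N) :
    ∑ l, g (l + c) = ∑ l, g l :=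
  Fintype.sum_equiv (Equiv.addRight c) _ _ (fun _ => rfl)

section Linked

variable {p q k : ℕ} {a b : ZMod (2 * k + 1) → ZMod p}

theorem Linked.shift_left (hq : 1 ≤ q) (hpq : 2 * q ≤ p) (hp4 : p < 4 * q) (h : Linked q a b)
    (l : ZMod (2 * k + 1)) : shift (a l) (a (l + 2)) =
      step (a l) (b (l + 1)) - step (a (l + 2)) (b (l + 1)) := by
  have h2 := (h (l + 2)).2
  rw [show l + 2 - 1 = l + 1 by ring] at h2
  rw [shift_eq_step_add_step hpq hp4 (h l).1 (circularComplete_symm hq hpq h2),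
    step_symm hq hpq h2]
  ring

theorem Linked.shift_right (hq : 1 ≤ q) (hpq : 2 * q ≤ p) (hp4 : p < 4 * q) (h : Linked q a b)
    (l : ZMod (2 * k + 1)) : shift (b l) (b (l + 2)) =
      step (a (l + 1)) (b (l + 2)) - step (a (l + 1)) (b l) := by
  obtain ⟨h1, h2⟩ := h (l + 1)
  rw [show l + 1 - 1 = l by ring] at h2
  rw [show l + 1 + 1 = l + 2 by ring] at h1
  rw [shift_eq_step_add_step hpq hp4 (circularComplete_symm hq hpq h2) h1,
    step_symm hq hpq h2]
  ring

theorem Linked.winding_left (hq : 1 ≤ q) (hpq : 2 * q ≤ p) (hp4 : p < 4 * q) (h : Linked q a b) :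
    winding a = ∑ l, step (a l) (b (l + 1)) - ∑ l, step (a l) (b (l - 1)) := by
  unfold winding
  rw [← sum_add_right (fun l => step (a l) (b (l - 1))) 2, ← Finset.sum_sub_distrib]
  refine Finset.sum_congr rfl fun l _ => ?_
  rw [h.shift_left hq hpq hp4, show l + 2 - 1 = l + 1 by ring]

/-- Both windings split into the same forward and backward step sums, up to translating the index.
-/
theorem Linked.winding_eq (hq : 1 ≤ q) (hpq : 2 * q ≤ p) (hp4 : p < 4 * q) (h : Linked q a b) :
    winding a = winding b := by
  rw [h.winding_left hq hpq hp4]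
  unfold winding
  rw [← sum_add_right (fun l => step (a l) (b (l - 1))) 1,
    ← sum_add_right (fun l => step (a l) (b (l + 1))) 1, ← Finset.sum_sub_distrib]
  refine Finset.sum_congr rfl fun l _ => ?_
  rw [h.shift_right hq hpq hp4, show l + 1 - 1 = l by ring, show l + 1 + 1 = l + 2 by ring]

/-- Modulo 2p each shift is a difference of representatives, and these telescope around the cycle.
-/
theorem two_mul_dvd_winding (a : ZMod (2 * k + 1) → ZMod p) : (2 * p : ℤ) ∣ winding a := by
  have h : winding a = ∑ l, (shift (a l) (a (l + 2)) -
      (2 * ((a (l + 2)).val : ℤ) - 2 * ((a l).val : ℤ))) := by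
    rw [Finset.sum_sub_distrib, Finset.sum_sub_distrib,
      sum_add_right (fun l => 2 * ((a l).val : ℤ)) 2]
    simp [winding]
  rw [h]
  exact Finset.dvd_sum fun l _ => two_mul_dvd_shift_sub _ _

/-- Two diagonal walks across a chain of linked sequences differ by a walk along the last one. -/
theorem sum_step_sub_sum_step (hq : 1 ≤ q) (hpq : 2 * q ≤ p) (hp4 : p < 4 * q)
    (A : ℕ → ZMod (2 * k + 1) → ZMod p) (hA : ∀ i, Linked q (A i) (A (i + 1))) (n : ℕ) :
    ∑ i ∈ Finset.range n, step (A i i) (A (i + 1) (i + 1)) -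
      ∑ i ∈ Finset.range n, step (A i (-i)) (A (i + 1) (-i - 1)) =
    ∑ i ∈ Finset.range n, shift (A n (-n + 2 * i)) (A n (-n + 2 * i + 2)) := by
  induction n with
  | zero => simp
  | succ n ih =>
    rw [Finset.sum_range_succ, Finset.sum_range_succ]
    -- Rows n and n + 1 are both expanded through the steps between them; the two expansions differ
    -- exactly by the new end terms of the two diagonals.
    have h1 : ∑ i ∈ Finset.range n, shift (A n (-n + 2 * i)) (A n (-n + 2 * i + 2)) =
        ∑ i ∈ Finset.range n, step (A n (-n + 2 * i)) (A (n + 1) (-n + 2 * i + 1)) -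
        ∑ i ∈ Finset.range n, step (A n (-n + 2 * (i + 1 : ℕ)))
          (A (n + 1) (-n + 2 * (i + 1 : ℕ) - 1)) := by
      rw [← Finset.sum_sub_distrib]
      refine Finset.sum_congr rfl fun i _ => ?_
      rw [(hA n).shift_left hq hpq hp4]
      push_cast
      ring_nf
    have h2 : ∑ i ∈ Finset.range (n + 1), shift (A (n + 1) (-(n + 1 : ℕ) + 2 * i))
          (A (n + 1) (-(n + 1 : ℕ) + 2 * i + 2)) =
        ∑ i ∈ Finset.range (n + 1), step (A n (-n + 2 * i)) (A (n + 1) (-n + 2 * i + 1)) -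
        ∑ i ∈ Finset.range (n + 1), step (A n (-n + 2 * i)) (A (n + 1) (-n + 2 * i - 1)) := by
      rw [← Finset.sum_sub_distrib]
      refine Finset.sum_congr rfl fun i _ => ?_
      rw [(hA n).shift_right hq hpq hp4]
      push_cast
      ring_nf
    rw [h2, Finset.sum_range_succ, Finset.sum_range_succ' (fun i : ℕ =>
      step (A n (-n + 2 * i)) (A (n + 1) (-n + 2 * i - 1)))]
    have h3 : (-n + 2 * n : ZMod (2 * k + 1)) = n := by ring
    rw [h3]
    simp only [Nat.cast_zero, mul_zero, add_zero]
    linear_combination ih + h1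

/-! ### Lifts and their averages -/

theorem two_mul_dvd_lift_sub (a : ZMod (2 * k + 1) → ZMod p) (j : ℕ) :
    (2 * p : ℤ) ∣ lift a j - 2 * ((a (2 * j)).val : ℤ) := by
  induction j with
  | zero => simp [lift]
  | succ j ih =>
    obtain ⟨c, hc⟩ := ih
    obtain ⟨d, hd⟩ := two_mul_dvd_shift_sub (a (2 * j)) (a (2 * j + 2))
    refine ⟨c + d, ?_⟩
    have : (2 * (j + 1 : ℕ) : ZMod (2 * k + 1)) = 2 * j + 2 := by push_cast; ring
    rw [this]
    unfold lift at hc ⊢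
    rw [Finset.sum_range_succ]
    linear_combination hc + hd

theorem lift_add_period (a : ZMod (2 * k + 1) → ZMod p) (j : ℕ) :
    lift a (j + (2 * k + 1)) = lift a j + winding a := by
  unfold lift winding
  rw [Finset.sum_range_add, ← sum_range_two_mul (fun l => shift (a l) (a (l + 2))) (2 * (j : ZMod _)),
    ← add_assoc]
  congr 1
  refine Finset.sum_congr rfl fun i _ => ?_
  push_cast
  ring_nf

/-- Sliding the window by one trades a lift for the lift one period later, which costs one winding.
-/
theorem sum_lift_add (a : ZMod (2 * k + 1) → ZMod p) (h : ℕ) :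
    ∑ j ∈ Finset.range (2 * k + 1), lift a (j + h) = liftSum a + h * winding a := by
  induction h with
  | zero => simp [liftSum]
  | succ h ih =>
    have h1 := Finset.sum_range_succ (fun j => lift a (j + h)) (2 * k + 1)
    have h2 := Finset.sum_range_succ' (fun j => lift a (j + h)) (2 * k + 1)
    have h3 := lift_add_period a h
    rw [add_comm h] at h3
    have h4 : ∀ j, j + 1 + h = j + (h + 1) := fun j => by ring
    simp only [h4, zero_add] at h2
    push_cast
    linear_combination ih - h2 + h1 + h3

/-- Since k + 1 is half of 1 modulo 2k + 1, the lift of `b` at j + k + 1 lies over b (2j + 1), a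
neighbour of a (2j). The constant `c` is independent of j because both sides grow by the same steps.
-/
theorem Linked.exists_lift_eq (hq : 1 ≤ q) (hpq : 2 * q ≤ p) (hp4 : p < 4 * q) (h : Linked q a b) :
    ∃ c : ℤ, ∀ j : ℕ, lift b (j + (k + 1)) =
      lift a j + p + step (a (2 * j)) (b (2 * j + 1)) + 2 * p * c := by
  have : NeZero p := ⟨by omega⟩
  have hk : (2 * (k + 1 : ℕ) : ZMod (2 * k + 1)) = 1 := by
    have := ZMod.natCast_self (2 * k + 1)
    push_cast at this ⊢
    linear_combination this
  obtain ⟨c, hc⟩ := two_mul_dvd_lift_sub b (k + 1)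
  obtain ⟨d, hd⟩ := two_mul_dvd_step_sub (a 0) (b 1)
  rw [hk] at hc
  refine ⟨c - d, fun j => ?_⟩
  induction j with
  | zero =>
    simp only [Nat.cast_zero, mul_zero, zero_add]
    simp only [lift, Finset.range_zero, Finset.sum_empty] at hc ⊢
    linear_combination hc - hd
  | succ j ih =>
    have h1 : lift b (j + 1 + (k + 1)) =
        lift b (j + (k + 1)) + shift (b (2 * j + 1)) (b (2 * j + 1 + 2)) := by
      have h2 : (2 * (j + (k + 1) : ℕ) : ZMod (2 * k + 1)) = 2 * j + 1 := by
        push_cast at hk ⊢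
        linear_combination hk
      unfold lift
      rw [show j + 1 + (k + 1) = j + (k + 1) + 1 by ring, Finset.sum_range_succ, h2]
      ring
    have h3 : lift a (j + 1) = lift a j + shift (a (2 * j)) (a (2 * j + 2)) := by
      unfold lift
      rw [Finset.sum_range_succ]
      ring
    rw [h1, h3, ih, h.shift_left hq hpq hp4, h.shift_right hq hpq hp4]
    push_cast
    ring_nf

theorem Linked.exists_abs_liftSum_sub_le (hq : 1 ≤ q) (hpq : 2 * q ≤ p) (hp4 : p < 4 * q)
    (h : Linked q a b) (hw : (4 * p : ℤ) ∣ winding a) :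
    ∃ c : ℤ, |liftSum b - liftSum a - (2 * k + 1) * p - 2 * p * (2 * k + 1) * c| ≤
      (2 * k + 1) * (p - 2 * q) := by
  obtain ⟨w, hw⟩ := hw
  obtain ⟨c, hc⟩ := h.exists_lift_eq hq hpq hp4
  -- Offsetting the index by k + 1 contributes about half a winding per entry; only an even number
  -- of turns makes this a whole number of turns, absorbed here by `w`.
  refine ⟨c - w, ?_⟩
  have h1 := sum_lift_add b (k + 1)
  simp only [hc, Finset.sum_add_distrib, Finset.sum_const, Finset.card_range, nsmul_eq_mul] at h1
  have h2 := sum_range_two_mul (fun l => step (a l) (b (l + 1))) 0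
  simp only [zero_add] at h2
  rw [h2, ← h.winding_eq hq hpq hp4] at h1
  have h3 := h.winding_left hq hpq hp4
  have bd : ∀ g : ZMod (2 * k + 1) → ℤ, (∀ l, |g l| ≤ p - 2 * q) →
      |∑ l, g l| ≤ (2 * k + 1) * (p - 2 * q) := by
    intro g hg
    refine (Finset.abs_sum_le_sum_abs _ _).trans ((Finset.sum_le_card_nsmul _ _ _
      fun l _ => hg l).trans ?_)
    simp [ZMod.card]
  have h4 := bd (fun l => step (a l) (b (l + 1))) fun l => abs_step_le hpq (h l).1
  have h5 := bd (fun l => step (a l) (b (l - 1))) fun l => abs_step_le hpq (h l).2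
  have h6 : liftSum a = ∑ j ∈ Finset.range (2 * k + 1), lift a j := rfl
  rw [← h6] at h1
  push_cast at h1
  -- As 2(k + 1) = (2k + 1) + 1, the one extra winding replaces a forward step sum by the backward
  -- one.
  have h7 : 2 * (liftSum b - liftSum a - (2 * k + 1) * p - 2 * p * (2 * k + 1) * (c - w)) =
      ∑ l, step (a l) (b (l + 1)) + ∑ l, step (a l) (b (l - 1)) := by
    rw [hw] at h1 h3
    linear_combination -2 * h1 - h3
  rw [abs_le] at h4 h5 ⊢
  constructor <;> linarith [h4.1, h4.2, h5.1, h5.2]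

/-- Modulo p, the averages differ by an amount between q and p - q. These bounds are integers, so
they survive rounding down. The factor 2 in the divisor undoes the doubling. -/
theorem Linked.adj_liftSum (hq : 1 ≤ q) (hpq : 2 * q ≤ p) (hp4 : p < 4 * q) (h : Linked q a b)
    (hw : (4 * p : ℤ) ∣ winding a) :
    (circularComplete p q).Adj ((liftSum a / (2 * (2 * k + 1)) : ℤ) : ZMod p)
      ((liftSum b / (2 * (2 * k + 1)) : ℤ) : ZMod p) := by
  have : NeZero p := ⟨by omega⟩
  obtain ⟨c, hc⟩ := h.exists_abs_liftSum_sub_le hq hpq hp4 hw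
  rw [abs_le] at hc
  have hN : (0 : ℤ) < 2 * (2 * k + 1) := by positivity
  set M : ℤ := 2 * (2 * k + 1) with hM
  have key : ∀ x y z : ℤ, x + z * M ≤ y → x / M + z ≤ y / M := fun x y z hxy => by
    rw [← Int.add_mul_ediv_right x z hN.ne']
    exact Int.ediv_le_ediv hN hxy
  have h1 := key (liftSum a) (liftSum b) (q + p * c) (by rw [hM]; linarith [hc.1])
  have h2 := key (liftSum b) (liftSum a) (q - p - p * c) (by rw [hM]; linarith [hc.2])
  set m : ℤ := liftSum b / M - liftSum a / M - p * c with hm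
  have hm1 : (q : ℤ) ≤ m := by linarith
  have hm2 : m ≤ p - q := by linarith
  obtain ⟨n, hn⟩ := Int.eq_ofNat_of_zero_le (show 0 ≤ m by omega)
  have hcast : ((liftSum b / M : ℤ) : ZMod p) - ((liftSum a / M : ℤ) : ZMod p) = (n : ZMod p) := by
    have h3 : ((m : ℤ) : ZMod p) = (n : ZMod p) := by rw [hn]; simp
    rw [← h3, hm]
    push_cast
    simp
  change q ≤ (_ : ZMod p).val ∧ (_ : ZMod p).val ≤ p - q
  rw [hcast, ZMod.val_natCast_of_lt (by omega)]
  omega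

end Linked

/-- The walk across a family of sequences given by a doubly cyclic array closes up with an odd
number of half turns, so one of the two windings is an even number of turns. -/
theorem four_mul_dvd_winding_or {p q k : ℕ} (hq : 1 ≤ q) (hpq : 2 * q ≤ p) (hp4 : p < 4 * q)
    (F : ZMod (2 * k + 1) → ZMod (2 * k + 1) → ZMod p)
    (hF : ∀ i, Linked q (F i) (F (i + 1)))
    (hF' : ∀ j, Linked q (fun i => F i j) (fun i => F i (j + 1))) :
    (4 * p : ℤ) ∣ winding (F 0) ∨ (4 * p : ℤ) ∣ winding (fun i => F i 0) := by
  have : NeZero p := ⟨by omega⟩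
  have hself : ((2 * k + 1 : ℕ) : ZMod (2 * k + 1)) = 0 := ZMod.natCast_self _
  have e1 := sum_step_sub_sum_step hq hpq hp4 (fun i : ℕ => F i)
    (fun i => by simpa using hF i) (2 * k + 1)
  have e2 := sum_step_sub_sum_step hq hpq hp4 (fun (j : ℕ) i => F i j)
    (fun j => by simpa using hF' j) (2 * k + 1)
  rw [sum_range_two_mul (fun l => shift (F (2 * k + 1 : ℕ) l) (F (2 * k + 1 : ℕ) (l + 2)))] at e1
  rw [sum_range_two_mul (fun l => shift (F l (2 * k + 1 : ℕ)) (F (l + 2) (2 * k + 1 : ℕ)))] at e2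
  simp only [hself] at e1 e2
  change _ = winding (F 0) at e1
  change _ = winding (fun i => F i 0) at e2
  push_cast at e1 e2
  rw [sum_range_natCast fun l => step (F l l) (F (l + 1) (l + 1)),
    sum_range_natCast fun l => step (F l (-l)) (F (l + 1) (-l - 1))] at e1
  rw [sum_range_natCast fun l => step (F l l) (F (l + 1) (l + 1)),
    sum_range_natCast fun l => step (F (-l) l) (F (-l - 1) (l + 1))] at e2
  -- The reindexing l ↦ -1 - l traverses the same antidiagonal backwards, so every step changes
  -- sign.
  have hQ : ∑ l, step (F l (-l)) (F (l + 1) (-l - 1)) =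
      -∑ l, step (F (-l) l) (F (-l - 1) (l + 1)) := by
    rw [← Finset.sum_neg_distrib]
    refine Fintype.sum_equiv (Equiv.subLeft (-1)) _ _ fun l => ?_
    have h := (hF l (-l)).2
    rw [Equiv.subLeft_apply, show -(-1 - l) = l + 1 by ring, show -1 - l = -l - 1 by ring,
      show l + 1 - 1 = l by ring, show -l - 1 + 1 = -l by ring, step_symm hq hpq h, neg_neg]
  have hP : ∑ l, step (F l l) (F (l + 1) (l + 1)) = ∑ l, (step (F l l) (F (l + 1) (l + 1)) -
      (2 * ((F (l + 1) (l + 1)).val : ℤ) - 2 * ((F l l).val : ℤ) - p)) - (2 * k + 1) * p := by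
    rw [Finset.sum_sub_distrib, Finset.sum_sub_distrib, Finset.sum_sub_distrib,
      sum_add_right (fun l => 2 * ((F l l).val : ℤ)) 1]
    simp [ZMod.card]
  obtain ⟨m, hm⟩ : (2 * p : ℤ) ∣ ∑ l, (step (F l l) (F (l + 1) (l + 1)) -
      (2 * ((F (l + 1) (l + 1)).val : ℤ) - 2 * ((F l l).val : ℤ) - p)) :=
    Finset.dvd_sum fun l _ => two_mul_dvd_step_sub _ _
  rw [hm] at hP
  obtain ⟨v, hv⟩ := two_mul_dvd_winding (F 0)
  obtain ⟨w, hw⟩ := two_mul_dvd_winding (fun i => F i 0)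
  have hp0 : (2 * p : ℤ) ≠ 0 := by have := NeZero.ne p; omega
  -- Adding `e1` and `e2` cancels the antidiagonals and doubles the diagonal, whose 2k + 1 half
  -- turns make the total number of turns odd.
  have hvw : v + w = 2 * m - (2 * k + 1) := by
    apply mul_left_cancel₀ hp0
    linear_combination -hv - hw - e1 - e2 + 2 * hP - hQ
  rcases Int.even_or_odd' v with ⟨t, rfl | rfl⟩
  · exact Or.inl ⟨t, by rw [hv]; ring⟩
  · exact Or.inr ⟨m - k - 1 - t, by rw [hw]; linear_combination (2 * p : ℤ) * hvw⟩

/-! ### Walks, components and odd cycles -/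

/-- `Walk G n u v`: there is a walk of length `n` from `u` to `v`. -/
def Walk {V : Type*} (G : Digraph V) : ℕ → V → V → Prop
  | 0, u, v => u = v
  | n + 1, u, v => ∃ w, Walk G n u w ∧ G.Adj w v

section Walk

variable {V : Type*} {G : Digraph V}

theorem Walk.trans {m n : ℕ} {u v w : V} (h : G.Walk m u v) (h' : G.Walk n v w) :
    G.Walk (m + n) u w := by
  induction n generalizing w with
  | zero => cases h'; exact h
  | succ n ih =>
    obtain ⟨x, hx, hxw⟩ := h'
    exact ⟨x, ih hx, hxw⟩

theorem Walk.symm (hG : ∀ u v : V, G.Adj u v → G.Adj v u) {n : ℕ} {u v : V} (h : G.Walk n u v) :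
    G.Walk n v u := by
  induction n generalizing v with
  | zero => exact Eq.symm h
  | succ n ih =>
    obtain ⟨x, hx, hxv⟩ := h
    rw [add_comm]
    exact Walk.trans (m := 1) ⟨v, rfl, hG _ _ hxv⟩ (ih hx)

theorem Walk.exists_nat {n : ℕ} {u v : V} (h : G.Walk n u v) :
    ∃ c : ℕ → V, c 0 = u ∧ c n = v ∧ ∀ i < n, G.Adj (c i) (c (i + 1)) := by
  induction n generalizing v with
  | zero => exact ⟨fun _ => u, rfl, h, by simp⟩
  | succ n ih =>
    obtain ⟨x, hx, hxv⟩ := h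
    obtain ⟨c, h0, hn, hc⟩ := ih hx
    refine ⟨fun i => if i ≤ n then c i else v, by simpa, by simp, fun i hi => ?_⟩
    rcases Nat.lt_succ_iff_lt_or_eq.mp hi with h1 | rfl
    · simpa [h1.le, Nat.succ_le_of_lt h1] using hc i h1
    · simpa [hn] using hxv

theorem Walk.exists_zmod {n : ℕ} [NeZero n] {u : V} (h : G.Walk n u u) :
    ∃ c : ZMod n → V, c 0 = u ∧ ∀ i, G.Adj (c i) (c (i + 1)) := by
  obtain ⟨c, h0, hn, hc⟩ := h.exists_nat
  refine ⟨fun i => c i.val, by simpa, fun i => ?_⟩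
  have h1 := hc i.val (ZMod.val_lt i)
  convert h1 using 1
  rcases (Nat.succ_le_of_lt (ZMod.val_lt i)).eq_or_lt with h2 | h2
  · have h3 : i + 1 = 0 := by
      have : ((i.val + 1 : ℕ) : ZMod n) = 0 := by
        rw [← Nat.succ_eq_add_one, h2, ZMod.natCast_self]
      simpa using this
    change c (i + 1).val = _
    rw [h3, ← Nat.succ_eq_add_one, h2, ZMod.val_zero, h0, hn]
  · have : i + 1 = ((i.val + 1 : ℕ) : ZMod n) := by simp
    change c (i + 1).val = _
    rw [this, ZMod.val_natCast_of_lt h2]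

/-- A graph maps to `K` as soon as each of its components does. -/
theorem homTo_of_forall_component {α : Type*} {K : Digraph α}
    (hG : ∀ u v : V, G.Adj u v → G.Adj v u)
    (h : ∀ u₀, ∃ f : V → α, ∀ n u v, G.Walk n u₀ u → G.Adj u v → K.Adj (f u) (f v)) :
    G.HomTo K := by
  choose f hf using h
  let s : Setoid V := ⟨fun u v => ∃ n, G.Walk n u v, fun u => ⟨0, rfl⟩,
    fun ⟨n, h⟩ => ⟨n, h.symm hG⟩, fun ⟨m, h⟩ ⟨n, h'⟩ => ⟨m + n, h.trans h'⟩⟩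
  refine ⟨fun u => f (Quotient.mk s u).out u, fun u v huv => ?_⟩
  have h1 : Quotient.mk s u = Quotient.mk s v := Quotient.sound ⟨1, u, rfl, huv⟩
  obtain ⟨n, hn⟩ : ∃ n, G.Walk n (Quotient.mk s u).out u := Quotient.mk_out (s := s) u
  change K.Adj (f (Quotient.mk s u).out u) (f (Quotient.mk s v).out v)
  rw [← h1]
  exact hf _ n u v hn huv

/-- A component without odd closed walks maps to every circular complete graph. -/
theorem exists_odd_walk {p q : ℕ} (hq : 1 ≤ q) (hpq : 2 * q ≤ p)
    (hG : ∀ u v : V, G.Adj u v → G.Adj v u) {u₀ : V}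
    (h : ¬ ∃ f : V → ZMod p, ∀ n u v, G.Walk n u₀ u → G.Adj u v →
      (circularComplete p q).Adj (f u) (f v)) :
    ∃ k, G.Walk (2 * k + 1) u₀ u₀ := by
  classical
  by_contra! hodd
  apply h
  have : NeZero p := ⟨by omega⟩
  have hadj : (circularComplete p q).Adj 0 q := by
    change q ≤ (_ : ZMod p).val ∧ (_ : ZMod p).val ≤ p - q
    rw [sub_zero, ZMod.val_natCast_of_lt (by omega)]
    omega
  refine ⟨fun u => if ∃ k, G.Walk (2 * k) u₀ u then 0 else q, fun n u v hu huv => ?_⟩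
  by_cases h1 : ∃ k, G.Walk (2 * k) u₀ u
  · have h2 : ¬ ∃ k, G.Walk (2 * k) u₀ v := by
      rintro ⟨l, hl⟩
      obtain ⟨k, hk⟩ := h1
      have h3 : G.Walk (2 * k + 1) u₀ v := ⟨u, hk, huv⟩
      have h4 := h3.trans (hl.symm hG)
      exact hodd (k + l) (by convert h4 using 1; ring)
    simpa [h1, h2] using hadj
  · have h2 : ∃ k, G.Walk (2 * k) u₀ v := by
      rcases Nat.even_or_odd' n with ⟨m, rfl | rfl⟩
      · exact absurd ⟨m, hu⟩ h1
      · exact ⟨m + 1, u, hu, huv⟩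
    simpa [h1, h2] using circularComplete_symm hq hpq hadj

end Walk

/-! ### Multiplicativity below four -/

section Multiplicative

variable {V W : Type*} {G : Digraph V} {H : Digraph W} {p q k : ℕ}

theorem exists_hom_component_of_winding (hq : 1 ≤ q) (hpq : 2 * q ≤ p) (hp4 : p < 4 * q)
    (A : V → ZMod (2 * k + 1) → ZMod p) (hA : ∀ u v, G.Adj u v → Linked q (A u) (A v)) {u₀ : V}
    (hw : (4 * p : ℤ) ∣ winding (A u₀)) :
    ∃ f : V → ZMod p, ∀ n u v, G.Walk n u₀ u → G.Adj u v →
      (circularComplete p q).Adj (f u) (f v) := by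
  have hconst : ∀ n u, G.Walk n u₀ u → winding (A u₀) = winding (A u) := by
    intro n
    induction n with
    | zero => rintro u rfl; rfl
    | succ n ih =>
      rintro u ⟨x, hx, hxu⟩
      exact (ih x hx).trans ((hA x u hxu).winding_eq hq hpq hp4)
  refine ⟨fun u => ((liftSum (A u) / (2 * (2 * k + 1)) : ℤ) : ZMod p), fun n u v hu huv => ?_⟩
  exact (hA u v huv).adj_liftSum hq hpq hp4 (hconst n u hu ▸ hw)

/-- The circular complete graphs `K_{p/q}` with `p / q < 4` are multiplicative. -/
theorem homTo_circularComplete_or_of_directProd (hq : 1 ≤ q) (hpq : 2 * q ≤ p) (hp4 : p < 4 * q)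
    (hG : ∀ u v : V, G.Adj u v → G.Adj v u) (hH : ∀ u v : W, H.Adj u v → H.Adj v u)
    (h : (G.directProd H).HomTo (circularComplete p q)) :
    G.HomTo (circularComplete p q) ∨ H.HomTo (circularComplete p q) := by
  obtain ⟨f, hf⟩ := h
  by_contra! hcon
  obtain ⟨hGK, hHK⟩ := hcon
  have hG0 := mt (homTo_of_forall_component hG) hGK
  have hH0 := mt (homTo_of_forall_component hH) hHK
  push Not at hG0 hH0
  obtain ⟨u₀, hu₀⟩ := hG0
  obtain ⟨v₀, hv₀⟩ := hH0
  have hu : ¬ ∃ f : V → ZMod p, ∀ n u v, G.Walk n u₀ u → G.Adj u v →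
      (circularComplete p q).Adj (f u) (f v) := by push Not; exact hu₀
  have hv : ¬ ∃ f : W → ZMod p, ∀ n u v, H.Walk n v₀ u → H.Adj u v →
      (circularComplete p q).Adj (f u) (f v) := by push Not; exact hv₀
  obtain ⟨m, hm⟩ := exists_odd_walk hq hpq hG hu
  obtain ⟨n, hn⟩ := exists_odd_walk hq hpq hH hv
  obtain ⟨c, hc0, hc⟩ := hm.exists_zmod
  obtain ⟨d, hd0, hd⟩ := hn.exists_zmod
  -- Repeating both closed walks up to the product of their lengths keeps the length odd and makes
  -- the array square, so its diagonals close up.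
  obtain ⟨k, hk⟩ : ∃ k, 2 * k + 1 = (2 * m + 1) * (2 * n + 1) := ⟨2 * m * n + m + n, by ring⟩
  let πm := ZMod.castHom (Dvd.intro _ hk.symm : 2 * m + 1 ∣ 2 * k + 1) (ZMod (2 * m + 1))
  let πn := ZMod.castHom (Dvd.intro_left _ hk.symm : 2 * n + 1 ∣ 2 * k + 1) (ZMod (2 * n + 1))
  let x : ZMod (2 * k + 1) → V := fun i => c (πm i)
  let y : ZMod (2 * k + 1) → W := fun i => d (πn i)
  have hx : ∀ i, G.Adj (x i) (x (i + 1)) := fun i => by simpa [x] using hc (πm i)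
  have hy : ∀ i, H.Adj (y i) (y (i + 1)) := fun i => by simpa [y] using hd (πn i)
  have hx' : ∀ i, G.Adj (x i) (x (i - 1)) := fun i => hG _ _ (by simpa using hx (i - 1))
  have hy' : ∀ i, H.Adj (y i) (y (i - 1)) := fun i => hH _ _ (by simpa using hy (i - 1))
  have hA : ∀ u v, G.Adj u v → Linked q (fun j => f (u, y j)) (fun j => f (v, y j)) :=
    fun u v huv j => ⟨hf ⟨huv, hy j⟩, hf ⟨huv, hy' j⟩⟩
  have hB : ∀ u v, H.Adj u v → Linked q (fun i => f (x i, u)) (fun i => f (x i, v)) :=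
    fun u v huv i => ⟨hf ⟨hx i, huv⟩, hf ⟨hx' i, huv⟩⟩
  have hx0 : x 0 = u₀ := by simpa [x] using hc0
  have hy0 : y 0 = v₀ := by simpa [y] using hd0
  rcases four_mul_dvd_winding_or hq hpq hp4 (fun i j => f (x i, y j)) (fun i => hA _ _ (hx i))
    (fun j => hB _ _ (hy j)) with hw | hw
  · exact hu (exists_hom_component_of_winding hq hpq hp4 (fun u j => f (u, y j)) hA
      (by simpa only [hx0] using hw))
  · exact hv (exists_hom_component_of_winding hq hpq hp4 (fun v i => f (x i, v)) hB
      (by simpa only [hy0] using hw))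

theorem HomTo.trans {U : Type*} {K : Digraph U} (h : G.HomTo H) (h' : H.HomTo K) : G.HomTo K := by
  obtain ⟨f, hf⟩ := h
  obtain ⟨g, hg⟩ := h'
  exact ⟨g ∘ f, fun _ _ huv => hg (hf huv)⟩

theorem circularChromaticNumber_le_of_homTo (h : G.HomTo H) :
    G.circularChromaticNumber ≤ H.circularChromaticNumber := by
  refine sInf_le_sInf ?_
  rintro x ⟨s, r, h1, h2, h3, rfl⟩
  exact ⟨s, r, h1, h2, h.trans h3, rfl⟩

end Multiplicative

end Digraph

theorem mainTheorem9 {V : Type*} {W : Type*} [Finite V] [Finite W]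
    (G : Digraph V) (H : Digraph W)
    (hG : ∀ u v : V, G.Adj u v → G.Adj v u) (hH : ∀ u v : W, H.Adj u v → H.Adj v u)
    (hmin : min G.circularChromaticNumber H.circularChromaticNumber ≤ 4) :
    (G.directProd H).circularChromaticNumber =
      min G.circularChromaticNumber H.circularChromaticNumber := by
  apply le_antisymm
  · exact le_min (Digraph.circularChromaticNumber_le_of_homTo ⟨Prod.fst, fun _ _ h => h.1⟩)
      (Digraph.circularChromaticNumber_le_of_homTo ⟨Prod.snd, fun _ _ h => h.2⟩)
  · refine le_sInf ?_
    rintro x ⟨s, r, hr, hrs, hhom, rfl⟩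
    by_contra! hlt
    have hr0 : (r : ℝ≥0∞) ≠ 0 := by simp; omega
    have hs4 : s < 4 * r := by
      have h1 := (ENNReal.div_lt_iff (Or.inl hr0) (Or.inl (ENNReal.natCast_ne_top r))).1
        (hlt.trans_le hmin)
      exact_mod_cast h1
    rcases Digraph.homTo_circularComplete_or_of_directProd hr hrs hs4 hG hH hhom with h | h
    · exact (hlt.trans_le (min_le_left _ _)).not_ge (sInf_le ⟨s, r, hr, hrs, h, rfl⟩)
    · exact (hlt.trans_le (min_le_right _ _)).not_ge (sInf_le ⟨s, r, hr, hrs, h, rfl⟩)
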